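/- Let $X$ be a compact metric space and let $\varphi:[0,\infty)\times X\to X$ be a semiflow (a continuous map with $\varphi(0,x)=x$ and $\varphi(s+t,x)=\varphi(s,\varphi(t,x))$; every flow restricts to one). For $Y\subset X$ put $\omega(Y)=\bigcap_{t>0}\mathrm{cl}\,\varphi([t,\infty),Y)$. A set $A\subset X$ is an attractor if $\omega(U)=A$ for some neighborhood $U$ of $A$; its dual repeller is $R=\{x\in X:\omega(x)\cap A=\emptyset\}$, and $(A,R)$ is then called an attractor–repeller pair. A set $S$ is invariant if $\varphi(t,S)=S$ for all $t\ge 0$, and $\mathrm{Inv}(N)$ denotes the union of all invariant subsets of $N$. An index pair for $S\subset X$ is a pair of compact sets $L\subset N\subset X$ such that (1) $S=\mathrm{Inv}(\mathrm{cl}(N\setminus L))$ and $N\setminus L$ is a neighborhood of $S$; (2) if $x\in L$ and $\varphi([0,t],x)\subset N$, then $\varphi([0,t],x)\subset L$; (3) if $x\in N$, $t_1>0$ and $\varphi(t_1,x)\notin N$, then there is $t_0\in[0,t_1]$ with $\varphi([0,t_0],x)\subset N$ and $\varphi(t_0,x)\in L$. The Conley index of $S$ is the graded group $CH_\bullet(S)=H_\bullet(N,L)$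 (singular homology with integer coefficients), computed from any index pair $(N,L)$ for $S$ with $H_\bullet(N,L)\cong\tilde H_\bullet(N/L)$. Here $N/L$ is pointed by the class of $L$, and $N/\emptyset$ is $N$ with a disjoint base point added. $CH_\bullet(X)$ denotes the Conley index of $\mathrm{Inv}(X)$, the maximal invariant set of $X$ (for which $(X,\emptyset)$ is such a pair, so that $CH_\bullet(X)\cong H_\bullet(X)$). Let $(A,R)$ be an attractor–repeller pair. If $CH_\bullet(A)\not\cong CH_\bullet(X)$, i.e. if for some choice of such index pairs the groups $CH_n(A)$ and $CH_n(X)$ are non-isomorphic for some $n$, then $R\neq\emptyset$. -/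

import Mathlib

open scoped NNReal

universe u

namespace Conley

section Dynamics

variable {X : Type u} [TopologicalSpace X]

/-- The omega-limit set `⋂ t, cl (φ([t, ∞), Y))` of `Y` under the semiflow `φ`. -/
def omega (φ : Flow ℝ≥0 X) (Y : Set X) : Set X :=
  omegaLimit Filter.atTop φ Y

/-- `A` is an attractor: some neighbourhood `U` of `A` satisfies `ω(U) = A`. -/
def IsAttractor (φ : Flow ℝ≥0 X) (A : Set X) : Prop :=
  ∃ U ∈ nhdsSet A, omega φ U = A

/-- The dual repeller of `A`: the points `x` with `ω(x) ∩ A = ∅`. -/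
def dualRepeller (φ : Flow ℝ≥0 X) (A : Set X) : Set X :=
  {x | omega φ {x} ∩ A = ∅}

/-- `(A, R)` is an attractor-repeller pair. -/
def IsAttractorRepellerPair (φ : Flow ℝ≥0 X) (A R : Set X) : Prop :=
  IsAttractor φ A ∧ R = dualRepeller φ A

/-- `S` is invariant: `φ(t, S) = S` for all `t ≥ 0` (equality, not just inclusion). -/
def IsInvariantSet (φ : Flow ℝ≥0 X) (S : Set X) : Prop :=
  ∀ t : ℝ≥0, φ t '' S = S

/-- `Inv(N)`: the union of all invariant sets contained in `N`. -/
def maxInv (φ : Flow ℝ≥0 X) (N : Set X) : Set X :=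
  ⋃₀ {S | S ⊆ N ∧ IsInvariantSet φ S}

/-- `(N, L)` is an index pair for `S`. In particular `S` is then an isolated invariant set, with
isolating neighbourhood `cl (N \ L)`. -/
structure IsIndexPair (φ : Flow ℝ≥0 X) (S N L : Set X) : Prop where
  isCompact_left : IsCompact N
  isCompact_right : IsCompact L
  subset : L ⊆ N
  eq_maxInv : S = maxInv φ (closure (N \ L))
  mem_nhdsSet : N \ L ∈ nhdsSet S
  /-- `L` is positively invariant in `N`. -/
  positivelyInvariant : ∀ x ∈ L, ∀ t : ℝ≥0, (∀ s ≤ t, φ s x ∈ N) → ∀ s ≤ t, φ s x ∈ L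
  /-- `L` is an exit set for `N`. -/
  exitSet : ∀ x ∈ N, ∀ t₁ : ℝ≥0, 0 < t₁ → φ t₁ x ∉ N →
    ∃ t₀ ≤ t₁, (∀ s ≤ t₀, φ s x ∈ N) ∧ φ t₀ x ∈ L

end Dynamics

section Homology

open CategoryTheory CategoryTheory.Limits

/-- The singular chain complex of a space, with integer coefficients. -/
noncomputable def singularChains : TopCat.{u} ⥤ ChainComplex AddCommGrpCat.{u} ℕ :=
  (AlgebraicTopology.singularChainComplexFunctor AddCommGrpCat.{u}).obj
    (AddCommGrpCat.of (ULift.{u} ℤ))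

/-- The inclusion of a subspace. -/
def subspaceInclusion (Y : Type u) [TopologicalSpace Y] (B : Set Y) :
    TopCat.of B ⟶ TopCat.of Y :=
  TopCat.ofHom ⟨Subtype.val, continuous_subtype_val⟩

/-- Relative singular homology `H_n(Y, B)` with integer coefficients: the homology of the
quotient complex `C(Y) / C(B)`. -/
noncomputable def relHomology (Y : Type u) [TopologicalSpace Y] (B : Set Y) (n : ℕ) :
    AddCommGrpCat.{u} :=
  (cokernel (singularChains.map (subspaceInclusion Y B))).homology n

/-- The equivalence relation on `Y ⊔ {pt}` that identifies all points of `B ⊔ {pt}`. -/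
def collapseSetoid (Y : Type u) (B : Set Y) : Setoid (Y ⊕ PUnit.{u + 1}) where
  r a b := a = b ∨
    (a ∈ Sum.inl '' B ∪ {Sum.inr PUnit.unit} ∧ b ∈ Sum.inl '' B ∪ {Sum.inr PUnit.unit})
  iseqv :=
    { refl := fun _ => Or.inl rfl
      symm := by
        rintro a b (h | ⟨ha, hb⟩)
        · exact Or.inl h.symm
        · exact Or.inr ⟨hb, ha⟩
      trans := by
        rintro a b c (rfl | ⟨ha, hb⟩) (rfl | ⟨hb', hc⟩)
        · exact Or.inl rfl
        · exact Or.inr ⟨hb', hc⟩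
        · exact Or.inr ⟨ha, hb⟩
        · exact Or.inr ⟨ha, hc⟩ }

/-- The quotient space `Y / B`, with the quotient topology. It carries a base point, the class of
`B`; by the usual convention `Y / ∅` is `Y` with a disjoint base point added. -/
abbrev PointedQuotient (Y : Type u) (B : Set Y) : Type u :=
  Quotient (collapseSetoid Y B)

/-- The base point of `Y / B`. -/
def basePoint (Y : Type u) (B : Set Y) : PointedQuotient Y B :=
  Quotient.mk (collapseSetoid Y B) (Sum.inr PUnit.unit)

/-- Reduced singular homology of the pointed space `Y / B`, as the homology of `Y / B` relative to
its base point. -/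
noncomputable def reducedQuotientHomology (Y : Type u) [TopologicalSpace Y] (B : Set Y) (n : ℕ) :
    AddCommGrpCat.{u} :=
  relHomology (PointedQuotient Y B) {basePoint Y B} n

/-- The pair `(Y, B)` satisfies `H_n(Y, B) ≅ H̃_n(Y / B)` for all `n`. -/
def IsHomologyGoodPair (Y : Type u) [TopologicalSpace Y] (B : Set Y) : Prop :=
  ∀ n : ℕ, Nonempty (relHomology Y B n ≅ reducedQuotientHomology Y B n)

/-- The graded group `C` is (up to isomorphism) the Conley index `CH(S) = H(N, L)`, computed from
some index pair `(N, L)` for `S` with `H(N, L) ≅ H̃(N / L)`. Such pairs all give the same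
graded group, whereas singular homology of an arbitrary index pair does depend on the pair. -/
def IsConleyIndex {X : Type u} [TopologicalSpace X] (φ : Flow ℝ≥0 X) (S : Set X)
    (C : ℕ → AddCommGrpCat.{u}) : Prop :=
  ∃ N L : Set X, IsIndexPair φ S N L ∧ IsHomologyGoodPair N (Subtype.val ⁻¹' L : Set N) ∧
    ∀ n : ℕ, Nonempty (C n ≅ relHomology N (Subtype.val ⁻¹' L : Set N) n)

end Homology

end Conley

/-!
Suppose the dual repeller is empty. Then every orbit enters the basin of `A` in a uniformly bounded
time, so `ω(X) ⊆ A` (`Conley.omega_univ_subset`). As `A` has an index pair, it is a union of invariant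
sets, so `ω(X) ⊆ A ⊆ Inv(X)`. It therefore suffices that all index pairs of sets containing `ω(X)`
have the same reduced homology `H̃(N / L)`.

For such a pair there is a time `T` from which on all orbits of `X` are in the neighbourhood `N \ L`.
This makes `N / L` pointed homotopy equivalent to `X` with a disjoint base point
(`Conley.IsIndexPair.exists_homotopyEquiv`): the map from `X` sends `x` to the class of `φ(T, x)`, and
the map back sends the class of `x` to `φ(T, x)` if the orbit stays in `N \ L` up to time `T`, and to
the base point otherwise. The two composites are the time-`2T` maps of the semiflows on `X` and on
`N / L`, hence homotopic to the identity. The essential point is the continuity of the collapsed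
semiflow on `N / L` (`Conley.IsIndexPair.continuousOn_collapsedFlow`), where positive invariance of
`L` and the exit property are used.

Finally, homotopy invariance of singular homology and the five lemma turn a pointed map that is a
homotopy equivalence into isomorphisms of reduced homology
(`Conley.nonempty_relHomology_singleton_iso`).
-/

namespace Conley

section Collapse

open Filter Topology Set
open scoped ContinuousMap

variable {X : Type u}

/-! ### The collapse map onto the quotient of an index pair -/

theorem eq_of_rel_collapseSetoid {Y Z : Type*} {B : Set Y} {f : Y ⊕ PUnit → Z}
    (hf : ∀ y ∈ B, f (Sum.inl y) = f (Sum.inr PUnit.unit)) {a b : Y ⊕ PUnit}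
    (hab : collapseSetoid Y B a b) : f a = f b := by
  have base {c : Y ⊕ PUnit} (hc : c ∈ Sum.inl '' B ∪ {Sum.inr PUnit.unit}) :
      f c = f (Sum.inr PUnit.unit) := by
    rcases hc with ⟨y, hy, rfl⟩ | rfl
    · exact hf y hy
    · rfl
  rcases hab with rfl | ⟨ha, hb⟩
  · rfl
  · rw [base ha, base hb]

open Classical in
/-- The map `X → N / L` that is the quotient map on `N` and sends every point outside `N` to the base
point. Being total on `X`, it can be composed with `φ t` without a proof that the orbit is in `N`. -/
noncomputable def collapse (N L : Set X) (x : X) :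
    PointedQuotient N (Subtype.val ⁻¹' L : Set N) :=
  if hx : x ∈ N then Quotient.mk _ (Sum.inl ⟨x, hx⟩) else basePoint _ _

theorem collapse_of_mem {N L : Set X} {x : X} (hx : x ∈ N) :
    collapse N L x = Quotient.mk _ (Sum.inl ⟨x, hx⟩) := dif_pos hx

theorem collapse_of_notMem_diff {N L : Set X} {x : X} (hx : x ∉ N \ L) :
    collapse N L x = basePoint _ _ := by
  by_cases hN : x ∈ N
  · rw [collapse_of_mem hN]
    refine Quotient.sound (Or.inr ⟨Or.inl ⟨_, ?_, rfl⟩, Or.inr rfl⟩)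
    exact by_contra fun hL => hx ⟨hN, hL⟩
  · exact dif_neg hN

variable [TopologicalSpace X]

theorem continuousOn_collapse (N L : Set X) : ContinuousOn (collapse N L) N := by
  rw [continuousOn_iff_continuous_domRestrict]
  have : N.domRestrict (collapse N L) = fun x => Quotient.mk _ (Sum.inl x) :=
    funext fun x => collapse_of_mem x.2
  rw [this]
  exact continuous_quotient_mk'.comp continuous_inl

/-- At the points of `L`, `collapse N L` is continuous even on approach from outside `N`. -/
theorem continuousAt_collapse {N L : Set X} (hN : IsClosed N) {x : X} (hx : x ∉ N \ L) :
    ContinuousAt (collapse N L) x := by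
  by_cases hxN : x ∈ N
  · have h₁ : Tendsto (collapse N L) (𝓝[N] x) (𝓝 (collapse N L x)) :=
      continuousOn_collapse N L x hxN
    have h₂ : Tendsto (collapse N L) (𝓝[Nᶜ] x) (𝓝 (collapse N L x)) := by
      refine tendsto_nhds_of_eventually_eq ?_
      filter_upwards [self_mem_nhdsWithin] with y hy
      rw [collapse_of_notMem_diff hx, collapse_of_notMem_diff fun h => hy h.1]
    simpa [ContinuousAt, ← nhdsWithin_union] using h₁.sup h₂
  · refine tendsto_nhds_of_eventually_eq ?_
    filter_upwards [hN.isOpen_compl.mem_nhds hxN] with y hy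
    rw [collapse_of_notMem_diff hx, collapse_of_notMem_diff fun h => hy h.1]

/-! ### Omega-limits and orbits in an index pair -/

/-- If the dual repeller of an attractor `A` is empty, then `A` attracts the whole space: by
compactness, all points enter a neighbourhood `U` with `ω(U) = A` within a common time. -/
theorem omega_univ_subset {φ : Flow ℝ≥0 X} [CompactSpace X] {A : Set X} (hA : IsAttractor φ A)
    (hR : dualRepeller φ A = ∅) : omega φ univ ⊆ A := by
  obtain ⟨U, hU, rfl⟩ := hA
  have hit (x : X) : ∃ t, φ t x ∈ interior U := by
    have hx : (omega φ {x} ∩ omega φ U).Nonempty := by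
      by_contra h
      exact hR.subset (show x ∈ dualRepeller φ (omega φ U) from not_nonempty_iff_eq_empty.1 h)
    obtain ⟨y, hyx, hyU⟩ := hx
    obtain ⟨_, hz, t, -, _, rfl, rfl⟩ :=
      mem_closure_iff.1 (omegaLimit_subset_closure_image2 _ _ _ univ_mem hyx) _ isOpen_interior
        (subset_interior_iff_mem_nhdsSet.2 hU hyU)
    exact ⟨t, hz⟩
  -- Finitely many times suffice for every orbit to have visited `U`; `F.sup id` bounds them.
  obtain ⟨F, hF⟩ := isCompact_univ.elim_finite_subcover (fun t => φ t ⁻¹' interior U)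
    (fun t => isOpen_interior.preimage (φ.continuous_toFun t))
    (fun x _ => mem_iUnion.2 (hit x))
  intro y hy
  refine mem_iInter₂.2 fun v hv => ?_
  obtain ⟨a, ha⟩ := mem_atTop_sets.1 hv
  refine closure_mono ?_ (omegaLimit_subset_closure_image2 _ _ _ (Ici_mem_atTop (a + F.sup id)) hy)
  rintro _ ⟨s, hs, x, -, rfl⟩
  obtain ⟨t, htF, ht⟩ := mem_iUnion₂.1 (hF (mem_univ x))
  have hts : a + t ≤ s := (add_le_add_right (Finset.le_sup (f := id) htF) a).trans hs
  refine ⟨s - t, ha _ (le_tsub_of_add_le_right hts), φ t x, interior_subset ht, ?_⟩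
  rw [← φ.map_add, tsub_add_cancel_of_le (le_add_self.trans hts)]

namespace IsIndexPair

theorem exists_forall_ge_mem_diff [CompactSpace X] {φ : Flow ℝ≥0 X} {S N L : Set X}
    (h : IsIndexPair φ S N L) (hS : omega φ univ ⊆ S) :
    ∃ T : ℝ≥0, ∀ t ≥ T, ∀ x, φ t x ∈ N \ L := by
  obtain ⟨T, hT⟩ := eventually_atTop.1 (eventually_mapsTo_of_isOpen_of_omegaLimit_subset _ _ _
    isOpen_interior (hS.trans (subset_interior_iff_mem_nhdsSet.2 h.mem_nhdsSet)))
  exact ⟨T, fun t ht x => interior_subset (hT t ht (mem_univ x))⟩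

variable {φ : Flow ℝ≥0 X} {S N L : Set X}

/-- An orbit starting in `N` that avoids `L` stays in `N`, since it can only leave through `L`. -/
theorem mem_diff_of_notMem (h : IsIndexPair φ S N L) {x : X} (hx : x ∈ N) {t : ℝ≥0}
    (ht : ∀ s ≤ t, φ s x ∉ L) : ∀ s ≤ t, φ s x ∈ N \ L := by
  intro s hs
  refine ⟨by_contra fun hsN => ?_, ht s hs⟩
  have hpos : 0 < s := pos_of_ne_zero fun h0 => hsN (by simpa [h0] using hx)
  obtain ⟨r, hrs, -, hr⟩ := h.exitSet x hx s hpos hsN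
  exact ht r (hrs.trans hs) hr

/-- An orbit that meets `L` and is later outside `L` has left `N` in between. -/
theorem exists_notMem_of_mem (h : IsIndexPair φ S N L) {x : X} {s t : ℝ≥0} (hst : s ≤ t)
    (hs : φ s x ∈ L) (ht : φ t x ∉ L) : ∃ r, s ≤ r ∧ r ≤ t ∧ φ r x ∉ N := by
  by_contra! hN
  refine ht ?_
  have := h.positivelyInvariant _ hs (t - s) (fun r hr => ?_) _ le_rfl
  · rwa [← φ.map_add, tsub_add_cancel_of_le hst] at this
  · rw [← φ.map_add]
    exact hN _ le_add_self ((le_tsub_iff_right hst).1 hr)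

variable [T2Space X]

theorem isOpen_setOf_forall_notMem (h : IsIndexPair φ S N L) :
    IsOpen {p : ℝ≥0 × X | ∀ s ≤ p.1, φ s p.2 ∉ L} := by
  -- Rescaling time turns the condition into one over a fixed compact interval.
  have key : {p : ℝ≥0 × X | ∀ s ≤ p.1, φ s p.2 ∉ L} =
      {p | ∀ r ∈ Icc (0 : ℝ≥0) 1, φ (r * p.1) p.2 ∉ L} := by
    ext ⟨t, x⟩
    refine ⟨fun hp r hr => hp _ (mul_le_of_le_one_left' hr.2), fun hp s hs => ?_⟩
    have hst : s / t * t = s := div_mul_cancel_of_imp fun h0 => le_antisymm (h0 ▸ hs) zero_le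
    exact hst ▸ hp (s / t) ⟨zero_le, div_le_one_of_le₀ hs zero_le⟩
  rw [key, isOpen_iff_mem_nhds]
  refine fun p hp => isCompact_Icc.eventually_forall_of_forall_eventually fun r hr => ?_
  have hc : Continuous fun z : (ℝ≥0 × X) × ℝ≥0 => φ (z.2 * z.1.1) z.1.2 := by fun_prop
  exact (h.isCompact_right.isClosed.isOpen_compl.preimage hc).mem_nhds (hp r hr)

end IsIndexPair

/-! ### The collapsed semiflow -/

open Classical in
/-- The semiflow induced on `N / L`: a point follows its orbit as long as this stays in `N \ L`, and
sits at the base point from then on. It is written here as a function of a representative `x`. -/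
noncomputable def collapsedFlow (φ : Flow ℝ≥0 X) (N L : Set X) (t : ℝ≥0) (x : X) :
    PointedQuotient N (Subtype.val ⁻¹' L : Set N) :=
  if ∀ s ≤ t, φ s x ∈ N \ L then collapse N L (φ t x) else basePoint _ _

theorem collapsedFlow_of_notMem_diff (φ : Flow ℝ≥0 X) {N L : Set X} {x : X} {s t : ℝ≥0}
    (hst : s ≤ t) (hs : φ s x ∉ N \ L) : collapsedFlow φ N L t x = basePoint _ _ :=
  if_neg fun h => hs (h s hst)

theorem collapsedFlow_zero (φ : Flow ℝ≥0 X) (N L : Set X) (x : X) :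
    collapsedFlow φ N L 0 x = collapse N L x := by
  by_cases hx : x ∈ N \ L
  · refine (if_pos fun s hs => ?_).trans (by rw [φ.map_zero_apply])
    rwa [nonpos_iff_eq_zero.1 hs, φ.map_zero_apply]
  · rw [collapse_of_notMem_diff hx]
    exact collapsedFlow_of_notMem_diff φ le_rfl (by rwa [φ.map_zero_apply])

/-- Joint continuity of the collapsed semiflow. A sudden jump to the base point can only happen
after an orbit has entered `L`; from then on it stays in `L`, which is already the base point, until
it leaves `N`, and leaving `N` is an open condition. -/
theorem IsIndexPair.continuousOn_collapsedFlow [T2Space X] {φ : Flow ℝ≥0 X} {S N L : Set X}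
    (h : IsIndexPair φ S N L) :
    ContinuousOn (fun p : ℝ≥0 × X => collapsedFlow φ N L p.1 p.2) (univ ×ˢ N) := by
  classical
  rintro ⟨t, x⟩ ⟨-, hx⟩
  have hφ : Continuous fun p : ℝ≥0 × X => φ p.1 p.2 := by fun_prop
  by_cases hP : ∀ s ≤ t, φ s x ∈ N \ L
  · have hev : ∀ᶠ p in 𝓝[univ ×ˢ N] (t, x), ∀ s ≤ p.1, φ s p.2 ∈ N \ L := by
      filter_upwards [mem_nhdsWithin_of_mem_nhds (h.isOpen_setOf_forall_notMem.mem_nhds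
        fun s hs => (hP s hs).2), self_mem_nhdsWithin] with p hp hpN
      exact h.mem_diff_of_notMem hpN.2 hp
    have hlim : Tendsto (fun p : ℝ≥0 × X => φ p.1 p.2) (𝓝[univ ×ˢ N] (t, x)) (𝓝[N] (φ t x)) :=
      tendsto_nhdsWithin_iff.2 ⟨hφ.continuousWithinAt, hev.mono fun p hp => (hp _ le_rfl).1⟩
    have := (continuousOn_collapse N L _ (hP t le_rfl).1).tendsto.comp hlim
    refine ContinuousWithinAt.congr_of_eventuallyEq this ?_ (if_pos hP)
    exact hev.mono fun p hp => if_pos hp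
  · by_cases ht : φ t x ∈ N \ L
    -- The orbit has left `N` strictly before `t`. Nearby orbits do so at the same time, so the map is
    -- locally constant with value the base point.
    · obtain ⟨s, hst, hs⟩ : ∃ s ≤ t, φ s x ∈ L := by
        by_contra! hL
        exact hP (h.mem_diff_of_notMem hx hL)
      obtain ⟨r, -, hrt, hr⟩ := h.exists_notMem_of_mem hst hs ht.2
      have hlt : r < t := hrt.lt_of_ne fun e => hr (e ▸ ht.1)
      refine ContinuousAt.continuousWithinAt (tendsto_nhds_of_eventually_eq ?_)
      have hr' : ∀ᶠ p : ℝ≥0 × X in 𝓝 (t, x), φ r p.2 ∈ Nᶜ :=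
        ((φ.continuous continuous_const continuous_snd).tendsto (t, x)).eventually
          (h.isCompact_left.isClosed.isOpen_compl.mem_nhds hr)
      filter_upwards [hr', continuous_fst.tendsto (t, x) |>.eventually (lt_mem_nhds hlt)]
        with p hp hp'
      exact (collapsedFlow_of_notMem_diff φ hp'.le fun h => hp h.1).trans (if_neg hP).symm
    -- The end point is collapsed to the base point, so both branches tend to the base point.
    · refine ContinuousAt.continuousWithinAt ?_
      have hb : collapse N L (φ t x) = basePoint _ _ := collapse_of_notMem_diff ht
      have := (continuousAt_collapse h.isCompact_left.isClosed ht).tendsto.comp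
        (hφ.tendsto (t, x))
      rw [hb] at this
      rw [ContinuousAt, collapsedFlow_of_notMem_diff φ le_rfl ht]
      exact this.if' tendsto_const_nhds

/-- If every orbit is in `N \ L` from time `T` on, then an orbit that enters `L` has to leave `N`
before `T`, which makes staying in `N \ L` up to time `T` a closed condition as well. -/
theorem IsIndexPair.isClopen_setOf_forall_mem_diff [T2Space X] {φ : Flow ℝ≥0 X} {S N L : Set X}
    (h : IsIndexPair φ S N L) {T : ℝ≥0} (hT : ∀ t ≥ T, ∀ x, φ t x ∈ N \ L) :
    IsClopen {x : N | ∀ s ≤ T, φ s x ∈ N \ L} := by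
  constructor
  · have : {x : N | ∀ s ≤ T, φ s x ∈ N \ L} = ⋂ s ≤ T, (fun x : N => φ s x) ⁻¹' N := by
      ext x
      simp only [mem_ofPred_eq, mem_iInter, mem_preimage]
      refine ⟨fun hx s hs => (hx s hs).1, fun hx s hs => ⟨hx s hs, fun hL => ?_⟩⟩
      obtain ⟨r, -, hrT, hr⟩ := h.exists_notMem_of_mem hs hL (hT T le_rfl x).2
      exact hr (hx r hrT)
    rw [this]
    exact isClosed_iInter fun s => isClosed_iInter fun _ =>
      h.isCompact_left.isClosed.preimage (φ.continuous continuous_const continuous_subtype_val)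
  · have : {x : N | ∀ s ≤ T, φ s x ∈ N \ L} =
        (fun x : N => (T, (x : X))) ⁻¹' {p : ℝ≥0 × X | ∀ s ≤ p.1, φ s p.2 ∉ L} := by
      ext x
      exact ⟨fun hx s hs => (hx s hs).2, fun hx => h.mem_diff_of_notMem x.2 hx⟩
    rw [this]
    exact h.isOpen_setOf_forall_notMem.preimage (by fun_prop)

/-! ### The homotopy type of the quotient -/

open Classical in
/-- If every orbit is in `N \ L` from time `T` on, then `N / L` and `X` with a disjoint base point are
pointed homotopy equivalent. Both maps follow the flow for time `T`, and the semiflows on both spaces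
provide the homotopies. -/
theorem IsIndexPair.exists_homotopyEquiv [T2Space X] {φ : Flow ℝ≥0 X} {S N L : Set X}
    (h : IsIndexPair φ S N L) {T : ℝ≥0} (hT : ∀ t ≥ T, ∀ x, φ t x ∈ N \ L) :
    ∃ e : PointedQuotient N (Subtype.val ⁻¹' L : Set N) ≃ₕ X ⊕ PUnit.{u + 1},
      e (basePoint _ _) = Sum.inr PUnit.unit ∧
      e.symm (Sum.inr PUnit.unit) = basePoint _ _ := by
  let Q := PointedQuotient N (Subtype.val ⁻¹' L : Set N)
  have hmem {x : X} (hx : ∀ s ≤ T, φ s x ∈ N \ L) (t : ℝ≥0) : φ t x ∈ N \ L :=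
    (le_total t T).elim (hx t) fun ht => hT t ht x
  have hφT : Continuous fun x : N => φ T x :=
    φ.continuous continuous_const continuous_subtype_val
  let g₀ : N ⊕ PUnit.{u + 1} → X ⊕ PUnit.{u + 1} :=
    Sum.elim (fun x => if ∀ s ≤ T, φ s x ∈ N \ L then Sum.inl (φ T x) else Sum.inr PUnit.unit)
      (fun _ => Sum.inr PUnit.unit)
  have hg₀ : Continuous g₀ := by
    refine Continuous.sumElim ?_ continuous_const
    refine continuous_if (fun x hx => ?_) (continuous_inl.comp hφT).continuousOn
      continuousOn_const
    rw [(h.isClopen_setOf_forall_mem_diff hT).frontier_eq] at hx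
    exact hx.elim
  have hg₀' : ∀ y ∈ (Subtype.val ⁻¹' L : Set N), g₀ (Sum.inl y) = g₀ (Sum.inr PUnit.unit) :=
    fun y hy => if_neg fun hP => (hP 0 zero_le).2 (by simpa using hy)
  let g : C(Q, X ⊕ PUnit.{u + 1}) :=
    ⟨Quotient.lift g₀ fun _ _ => eq_of_rel_collapseSetoid hg₀', hg₀.quotient_lift _⟩
  let f : C(X ⊕ PUnit.{u + 1}, Q) :=
    ⟨Sum.elim (fun x => collapse N L (φ T x)) fun _ => basePoint _ _,
      ((continuousOn_collapse N L).comp_continuous (φ.continuous_toFun T)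
        fun x => (hT T le_rfl x).1).sumElim continuous_const⟩
  let c₀ (t : ℝ≥0) : N ⊕ PUnit.{u + 1} → Q :=
    Sum.elim (fun x => collapsedFlow φ N L t x) fun _ => basePoint _ _
  let c (t : ℝ≥0) : Q → Q := Quotient.lift (c₀ t) fun _ _ => eq_of_rel_collapseSetoid fun y hy =>
    collapsedFlow_of_notMem_diff φ (zero_le (a := t)) (fun hy' => hy'.2 (by simpa using hy))
  have hc : Continuous fun p : Q × ℝ≥0 => c p.2 p.1 := by
    refine isQuotientMap_quotient_mk'.continuous_lift_prod_left ?_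
    refine (Homeomorph.sumProdDistrib.symm.isQuotientMap.continuous_iff).2
      (continuous_sum_dom.2 ⟨?_, ?_⟩)
    · exact h.continuousOn_collapsedFlow.comp_continuous
        (f := fun p : N × ℝ≥0 => (p.2, (p.1 : X))) (by fun_prop) fun p => ⟨mem_univ _, p.1.2⟩
    · exact continuous_const
  have hc_zero (q : Q) : c 0 q = q := by
    obtain ⟨x | x⟩ := q
    · exact (collapsedFlow_zero φ N L x).trans (collapse_of_mem x.2)
    · rfl
  -- Orbits are in `N \ L` after time `T`, so only the first half of `[0, T + T]` can lead to the base
  -- point.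
  have hc_add (q : Q) : c (T + T) q = f (g q) := by
    obtain ⟨x | x⟩ := q
    · change collapsedFlow φ N L (T + T) x = f (if _ then _ else _)
      split_ifs with hP
      · exact (if_pos fun s _ => hmem hP s).trans (congrArg _ (φ.map_add T T x))
      · push Not at hP
        obtain ⟨s, hs, hsx⟩ := hP
        exact collapsedFlow_of_notMem_diff φ (hs.trans le_self_add) hsx
    · rfl
  let scale (r : unitInterval) : ℝ≥0 := unitInterval.toNNReal r * (T + T)
  have hscale : Continuous scale := by fun_prop
  have hscale_zero : scale 0 = 0 := by simp [scale]
  have hscale_one : scale 1 = T + T := by simp [scale]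
  have left : (ContinuousMap.id Q).Homotopic (f.comp g) :=
    ⟨{ toFun p := c (scale p.1) p.2
       continuous_toFun := hc.comp
        (continuous_snd.prodMk (hscale.comp continuous_fst))
       map_zero_left q := by rw [hscale_zero]; exact hc_zero q
       map_one_left q := by rw [hscale_one]; exact hc_add q }⟩
  have right : (ContinuousMap.id (X ⊕ PUnit.{u + 1})).Homotopic (g.comp f) :=
    ⟨{ toFun p := Sum.map (φ (scale p.1)) id p.2
       continuous_toFun := by
        refine (Homeomorph.prodSumDistrib.symm.isQuotientMap.continuous_iff).2
          (continuous_sum_dom.2 ⟨?_, continuous_inr.comp continuous_snd⟩)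
        exact continuous_inl.comp
          (φ.continuous (hscale.comp continuous_fst) continuous_snd)
       map_zero_left := by
        rintro (x | x)
        · exact congrArg Sum.inl (by rw [hscale_zero]; exact φ.map_zero_apply x)
        · rfl
       map_one_left := by
        rintro (x | x)
        · have hgf : g (f (Sum.inl x)) = Sum.inl (φ (T + T) x) := by
            change g (collapse N L (φ T x)) = _
            rw [collapse_of_mem (hT T le_rfl x).1, φ.map_add]
            refine if_pos fun s _ => ?_
            rw [← φ.map_add]
            exact hT _ le_add_self x
          exact (congrArg (fun t => Sum.inl (φ t x)) hscale_one).trans hgf.symm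
        · rfl }⟩
  exact ⟨⟨g, f, left.symm, right.symm⟩, rfl, rfl⟩

end Collapse

/-! ### Homology of pointed homotopy equivalences -/

section Homology

open CategoryTheory CategoryTheory.Limits
open scoped ContinuousMap

/-- Homotopy invariance of singular homology, for a homotopy equivalence. -/
theorem quasiIso_singularChains_map {Y Z : Type u} [TopologicalSpace Y] [TopologicalSpace Z]
    (e : Y ≃ₕ Z) : QuasiIso (singularChains.map (TopCat.ofHom e.toFun)) := by
  let R := AddCommGrpCat.of (ULift.{u} ℤ)
  obtain ⟨H⟩ := e.left_inv
  obtain ⟨K⟩ := e.right_inv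
  let H' : TopCat.Homotopy (TopCat.ofHom e.toFun ≫ TopCat.ofHom e.invFun) (𝟙 (TopCat.of Y)) := H
  let K' : TopCat.Homotopy (TopCat.ofHom e.invFun ≫ TopCat.ofHom e.toFun) (𝟙 (TopCat.of Z)) := K
  let E : HomotopyEquiv (singularChains.obj (TopCat.of Y)) (singularChains.obj (TopCat.of Z)) :=
    { hom := singularChains.map (TopCat.ofHom e.toFun)
      inv := singularChains.map (TopCat.ofHom e.invFun)
      homotopyHomInvId := (Homotopy.ofEq (singularChains.map_comp _ _).symm).trans
        ((H'.singularChainComplexFunctorObjMap R).trans (Homotopy.ofEq (singularChains.map_id _)))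
      homotopyInvHomId := (Homotopy.ofEq (singularChains.map_comp _ _).symm).trans
        ((K'.singularChainComplexFunctorObjMap R).trans (Homotopy.ofEq (singularChains.map_id _))) }
  exact E.quasiIso_hom

instance (Y : Type u) [TopologicalSpace Y] (B : Set Y) :
    Mono (singularChains.map (subspaceInclusion Y B)) := by
  have : Mono (subspaceInclusion Y B) :=
    (TopCat.mono_iff_injective _).2 Subtype.val_injective
  unfold singularChains
  infer_instance

/-- The five lemma reduces the relative statement to the absolute one: a pointed map that is an
(unpointed) homotopy equivalence induces isomorphisms of homology relative to the base points. -/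
theorem nonempty_relHomology_singleton_iso {Y Z : Type u} [TopologicalSpace Y]
    [TopologicalSpace Z] (e : Y ≃ₕ Z) (y : Y) (z : Z) (hyz : e y = z) (n : ℕ) :
    Nonempty (relHomology Y {y} n ≅ relHomology Z {z} n) := by
  let pt : ({y} : Set Y) ≃ₜ ({z} : Set Z) := Homeomorph.homeomorphOfUnique _ _
  let φ₁ := singularChains.map (TopCat.ofHom (pt.toHomotopyEquiv.toFun))
  let φ₂ := singularChains.map (TopCat.ofHom e.toFun)
  have comm : singularChains.map (subspaceInclusion Y {y}) ≫ φ₂ =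
      φ₁ ≫ singularChains.map (subspaceInclusion Z {z}) := by
    rw [← singularChains.map_comp, ← singularChains.map_comp]
    congr 1
    ext x
    obtain ⟨x, rfl⟩ := x
    exact hyz.trans (pt ⟨x, rfl⟩).2.symm
  let φ : ShortComplex.mk _ _ (cokernel.condition (singularChains.map (subspaceInclusion Y {y}))) ⟶
      ShortComplex.mk _ _ (cokernel.condition (singularChains.map (subspaceInclusion Z {z}))) :=
    { τ₁ := φ₁
      τ₂ := φ₂
      τ₃ := cokernel.map _ _ φ₁ φ₂ comm
      comm₁₂ := comm.symm
      comm₂₃ := (cokernel.π_desc _ _ _).symm }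
  have := HomologicalComplex.HomologySequence.quasiIso_τ₃ φ
    { exact := ShortComplex.exact_of_g_is_cokernel _ (cokernelIsCokernel _) }
    { exact := ShortComplex.exact_of_g_is_cokernel _ (cokernelIsCokernel _) }
    (quasiIso_singularChains_map _) (quasiIso_singularChains_map _)
  exact ⟨isoOfQuasiIsoAt φ.τ₃ n⟩

/-- Both quotients are pointed homotopy equivalent to `X` with a disjoint base point, so the two index
pairs may even belong to different sets. -/
theorem IsIndexPair.nonempty_reducedQuotientHomology_iso {X : Type u} [TopologicalSpace X]
    [CompactSpace X] [T2Space X] {φ : Flow ℝ≥0 X} {S₁ N₁ L₁ S₂ N₂ L₂ : Set X}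
    (h₁ : IsIndexPair φ S₁ N₁ L₁) (h₂ : IsIndexPair φ S₂ N₂ L₂)
    (hS₁ : omega φ Set.univ ⊆ S₁) (hS₂ : omega φ Set.univ ⊆ S₂) (n : ℕ) :
    Nonempty (reducedQuotientHomology N₁ (Subtype.val ⁻¹' L₁ : Set N₁) n ≅
      reducedQuotientHomology N₂ (Subtype.val ⁻¹' L₂ : Set N₂) n) := by
  obtain ⟨T₁, hT₁⟩ := h₁.exists_forall_ge_mem_diff hS₁
  obtain ⟨T₂, hT₂⟩ := h₂.exists_forall_ge_mem_diff hS₂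
  obtain ⟨e₁, he₁, -⟩ := h₁.exists_homotopyEquiv hT₁
  obtain ⟨e₂, -, he₂⟩ := h₂.exists_homotopyEquiv hT₂
  exact nonempty_relHomology_singleton_iso (e₁.trans e₂.symm) _ _
    ((congrArg e₂.symm he₁).trans he₂) n

end Homology
end Conley

theorem mainTheorem6 {X : Type u} [MetricSpace X] [CompactSpace X] (φ : Flow ℝ≥0 X)
    (A R : Set X) (hAR : Conley.IsAttractorRepellerPair φ A R)
    (CA CX : ℕ → AddCommGrpCat.{u})
    (hA : Conley.IsConleyIndex φ A CA)
    (hX : Conley.IsConleyIndex φ (Conley.maxInv φ Set.univ) CX)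
    (hne : ¬ ∀ n : ℕ, Nonempty (CategoryTheory.Iso (CA n) (CX n))) :
    R.Nonempty := by
  by_contra hR
  rw [hAR.2, Set.not_nonempty_iff_eq_empty] at hR
  have hωA := Conley.omega_univ_subset hAR.1 hR
  obtain ⟨N₁, L₁, h₁, good₁, iso₁⟩ := hA
  obtain ⟨N₂, L₂, h₂, good₂, iso₂⟩ := hX
  have hAinv : A ⊆ Conley.maxInv φ Set.univ := by
    rw [h₁.eq_maxInv]
    exact Set.sUnion_subset_sUnion fun S hS => ⟨Set.subset_univ S, hS.2⟩
  refine hne fun n => ?_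
  obtain ⟨a₁⟩ := iso₁ n
  obtain ⟨b₁⟩ := good₁ n
  obtain ⟨c⟩ := h₁.nonempty_reducedQuotientHomology_iso h₂ hωA (hωA.trans hAinv) n
  obtain ⟨b₂⟩ := good₂ n
  obtain ⟨a₂⟩ := iso₂ n
  exact ⟨a₁.trans (b₁.trans (c.trans (b₂.symm.trans a₂.symm)))⟩
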